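/- Let $n\ge 0$, $k\ge 1$, $r\ge 2$ be integers with $k+1$ and $r-1$ coprime, and let $t,q\in\mathbb C$ be primitive roots of unity of orders $k+1$ and $r-1$. Let $F_n^{(k,r)}$ be the space of symmetric polynomials $f\in\mathbb C[x_1,\dots,x_n]^{\mathfrak S_n}$ which vanish whenever $x_i=t^{i-1}q^{s_i}x_1$ for $1<i\le k+1$, for all $s_2,\dots,s_{k+1}\in\{0,\dots,r-2\}$ (no condition if $n\le k$). In particular, $F_n^{(k,2)}$ (where $q=1$) is given by the single condition $f(x,tx,\dots,t^kx,x_{k+2},\dots,x_n)=0$. Let $\mathcal F$ be the Frobenius homomorphism $f(x_1,\dots,x_n)\mapsto f(x_1^{r-1},\dots,x_n^{r-1})$ of $\mathbb C[x_1,\dots,x_n]$, and put $R_n=\mathcal F(F_n^{(k,2)})$, which is an ideal of the ring $A=\mathcal F(\mathbb C[x_1,\dots,x_n]^{\mathfrak S_n})$. A partition is a sequence of integers $\lambda=(\lambda_1\ge\dots\ge\lambda_n\ge 0)$. It is called admissible if every integer $i\ge 0$ occurs at most $k$ times among $\lambda_1,\dots,\lambda_n$, and $(r-1)$-slim if $\lambda_i-\lambda_{i+1}<r-1$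 for $1\le i<n$ and $\lambda_n<r-1$. A symmetric polynomial $g$ has highest partition $\mu$ if $g=c_\mu m_\mu+\sum_{\nu<\mu}c_\nu m_\nu$ with $c_\mu\ne 0$, where the $m_\nu$ are the monomial symmetric polynomials and $<$ is the dominance order on partitions of the same weight. There are exactly $(r-1)^n$ $(r-1)$-slim partitions, and $F_n^{(k,2)}$ has a basis indexed by the admissible partitions. For each $(r-1)$-slim partition $\mu$ let $g_\mu$ be any symmetric polynomial with highest partition $\mu$. Then: (1) For every basis $\{\tilde f_\lambda\}$ of the vector space $F_n^{(k,2)}$ indexed by the admissible partitions $\lambda$, with $f_\lambda=\mathcal F(\tilde f_\lambda)$, the products $f_\lambda g_\mu$ ($\lambda$ admissible, $\mu$ $(r-1)$-slim) form a basis of the vector space $F_n^{(k,r)}$. (2) $F_n^{(k,r)}$ is free of rank $(r-1)^n$ over the (in general non-unital) ring $R_n$, in the sense that $(a_\mu)_\mu\mapsto\sum_\mu a_\mu g_\mu$ is an isomorphism of $A$-modules (hence of $R_n$-modules) from $\bigoplus_\mu R_n$, the sum over the $(r-1)$-slim partitions $\mu$, onto $F_n^{(k,r)}$. -/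

import Mathlib

open MvPolynomial

noncomputable section

/-- Partitions of length at most `n`: nonincreasing sequences of `n` nonnegative integers.
The part usually called `λ_{i+1}` is the value at `i : Fin n`. -/
abbrev Ptn (n : ℕ) : Type := {l : Fin n → ℕ // Antitone l}

/-- `m_i(λ) ≤ k` for all `i`, where `m_i(λ)` is the number of parts equal to `i`
(zero parts are counted too). -/
def IsAdmissible {n : ℕ} (k : ℕ) (l : Ptn n) : Prop :=
  ∀ i : ℕ, (Finset.univ.filter (fun j : Fin n => l.1 j = i)).card ≤ k

/-- `m`-slim partitions: consecutive differences and the last part are less than `m`. -/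
def IsSlim {n : ℕ} (m : ℕ) (l : Ptn n) : Prop :=
  (∀ i j : Fin n, (i : ℕ) + 1 = (j : ℕ) → l.1 i < l.1 j + m) ∧
    ∀ i : Fin n, (i : ℕ) + 1 = n → l.1 i < m

abbrev AdmissiblePtn (n k : ℕ) : Type := {l : Ptn n // IsAdmissible k l}

abbrev SlimPtn (n m : ℕ) : Type := {l : Ptn n // IsSlim m l}

/-- The strict dominance order `ν < μ` on partitions of the same weight. -/
def DomLT {n : ℕ} (ν μ : Ptn n) : Prop :=
  ν ≠ μ ∧ ∑ i, ν.1 i = ∑ i, μ.1 i ∧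
    ∀ j : Fin n, ∑ i ∈ Finset.Iic j, ν.1 i ≤ ∑ i ∈ Finset.Iic j, μ.1 i

/-- The monomial symmetric polynomial `m_λ`: the sum of the distinct monomials
`x^a`, with `a` a rearrangement of `λ`. -/
def monomialSymm {n : ℕ} (l : Ptn n) : MvPolynomial (Fin n) ℂ :=
  ∑ a ∈ Finset.univ.image (fun w : Equiv.Perm (Fin n) => l.1 ∘ w),
    monomial (Finsupp.equivFunOnFinite.symm a) 1

/-- `f = c_μ m_μ + ∑_{ν < μ} c_ν m_ν` with `c_μ ≠ 0`. -/
def HasHighestPtn {n : ℕ} (f : MvPolynomial (Fin n) ℂ) (μ : Ptn n) : Prop :=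
  ∃ c : Ptn n →₀ ℂ, c μ ≠ 0 ∧ (∀ ν ∈ c.support, ν = μ ∨ DomLT ν μ) ∧
    f = c.sum (fun ν a => a • monomialSymm ν)

/-- The point `x` satisfies `x_i = t^{i-1} q^{s_i} x_1` (`1 < i ≤ k + 1`) for some
`s_2, …, s_{k+1} ∈ {0, …, r - 2}`; there are no such points if `n < k + 1`. -/
def OnWheel (n k r : ℕ) (t q : ℂ) (x : Fin n → ℂ) : Prop :=
  ∃ h : k < n, ∀ i : Fin n, 0 < (i : ℕ) → (i : ℕ) ≤ k →
    ∃ s : ℕ, s < r - 1 ∧ x i = t ^ (i : ℕ) * q ^ s * x ⟨0, Nat.zero_lt_of_lt h⟩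

/-- The space `F_n^{(k,r)}` of symmetric polynomials in `n` variables satisfying the wheel
condition for the wheel set `{t, tq, …, tq^{r-2}}`. -/
def wheelSpace (n k r : ℕ) (t q : ℂ) : Submodule ℂ (MvPolynomial (Fin n) ℂ) where
  carrier := {f | f.IsSymmetric ∧ ∀ x, OnWheel n k r t q x → eval x f = 0}
  add_mem' := fun ha hb => ⟨ha.1.add hb.1, fun x hx => by simp [ha.2 x hx, hb.2 x hx]⟩
  zero_mem' := ⟨IsSymmetric.zero, fun x _ => by simp⟩
  smul_mem' := fun c f hf => ⟨hf.1.smul c, fun x hx => by simp [smul_eval, hf.2 x hx]⟩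

/-- The Frobenius homomorphism `f(x_1, …, x_n) ↦ f(x_1^m, …, x_n^m)`. -/
abbrev frob (n m : ℕ) : MvPolynomial (Fin n) ℂ →ₐ[ℂ] MvPolynomial (Fin n) ℂ :=
  MvPolynomial.expand m

/-- The Frobenius image of the ring of all symmetric polynomials. -/
abbrev frobSymm (n m : ℕ) : Subalgebra ℂ (MvPolynomial (Fin n) ℂ) :=
  (symmetricSubalgebra (Fin n) ℂ).map (frob n m)

/-- The Frobenius image `R_n` of `F_n^{(k,2)}`, as an ideal of the Frobenius image of the
ring of symmetric polynomials (in particular it is a ring, without unit in general). -/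
def frobWheel (n k r : ℕ) (t : ℂ) : Ideal (frobSymm n (r - 1)) where
  carrier := {f | ∃ p ∈ wheelSpace n k 2 t 1, frob n (r - 1) p = f}
  add_mem' := by
    rintro a b ⟨p, hp, hpa⟩ ⟨p', hp', hpb⟩
    exact ⟨p + p', add_mem hp hp', by rw [map_add, hpa, hpb]; rfl⟩
  zero_mem' := ⟨0, zero_mem _, by rw [map_zero]; rfl⟩
  smul_mem' := by
    rintro ⟨_, c, hc, rfl⟩ b ⟨p, hp, hpb⟩
    refine ⟨c * p, ⟨IsSymmetric.mul hc hp.1, fun x hx => ?_⟩, ?_⟩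
    · rw [map_mul, hp.2 x hx, mul_zero]
    · rw [map_mul, hpb]; rfl

/-- `F_n^{(k,r)}` as a module over the Frobenius image of the ring of symmetric polynomials. -/
def wheelModule (n k r : ℕ) (t q : ℂ) :
    Submodule (frobSymm n (r - 1)) (MvPolynomial (Fin n) ℂ) where
  carrier := wheelSpace n k r t q
  add_mem' := fun ha hb => add_mem ha hb
  zero_mem' := zero_mem (wheelSpace n k r t q)
  smul_mem' := by
    rintro ⟨_, c, hc, rfl⟩ f hf
    refine ⟨IsSymmetric.mul (fun e => ?_) hf.1, fun x hx => ?_⟩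
    · change rename e (expand (r - 1) c) = expand (r - 1) c
      rw [rename_expand, hc e]
    · change eval x (expand (r - 1) c * f) = 0
      rw [map_mul, hf.2 x hx, mul_zero]

end

/-! Put `m = r - 1`. Dividing the successive differences of a partition by `m` writes it uniquely as
`m • ν + μ` with `μ` slim. Dominance implies lexicographic order, so `p(x^m) * g μ` has leading
exponent `m • lead(p) + μ`. Hence every symmetric polynomial is uniquely a sum `∑ p_μ(x^m) g_μ` with
all `p_μ` symmetric (`exists_eq_sum_expand_mul`, `eq_of_sum_expand_mul_eq`). It remains to see that
the sum lies in `F_n^{(k,r)}` iff every `p_μ` lies in `F_n^{(k,2)}`.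

If: taking `m`-th powers of a wheel point erases the powers of `q` and replaces `t` by `t^m`; as `m`
is prime to `k + 1`, this only permutes the wheel (`expand_mul_mem_wheelSpace`).

Only if: the wheel points are stable under independent multiplication of the coordinates by powers
of `q`, which does not change the values `p_μ(x^m)`. These values therefore solve a homogeneous
linear system with square matrix `g_μ(q^s x)` of size `m^n`. At a general point it is invertible,
because symmetric polynomials separate the twisted points and are themselves combinations of the
`g_μ` (`eval_pow_eq_zero_of_sum_expand_mul`). So `p_μ` vanishes at general wheel points, hence at
all of them (`eval_wheelSubst_eq_zero`).

Existence of a basis of `F_n^{(k,2)}` indexed by admissible partitions is a count of dimensions: for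
`n > 0` both sides are countably infinite. -/

noncomputable section

/-! ### Division of partitions by `m` with slim remainder -/

section Partitions

variable {n m : ℕ}

lemma antitone_accumulate (d : Fin n → ℕ) : Antitone (Fin.accumulate n n d) := by
  intro i j hij
  simp only [Fin.accumulate_apply]
  refine Finset.sum_le_sum_of_subset fun x hx => ?_
  simp only [Finset.mem_filter, Finset.mem_univ, true_and] at hx ⊢
  exact (Fin.le_def.mp hij).trans hx

/-- A partition is determined by its successive differences. -/
def differencesEquiv (n : ℕ) : (Fin n → ℕ) ≃ Ptn n :=
  Equiv.ofBijective (fun d => ⟨Fin.accumulate n n d, antitone_accumulate d⟩)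
    ⟨fun _ _ h => Fin.accumulate_injective le_rfl (congrArg Subtype.val h),
      fun l => ⟨_, Subtype.ext (Fin.accumulate_invAccumulate le_rfl l.2)⟩⟩

lemma coe_differencesEquiv (d : Fin n → ℕ) :
    (differencesEquiv n d).1 = Fin.accumulate n n d := rfl

lemma isSlim_differencesEquiv (d : Fin n → ℕ) :
    IsSlim m (differencesEquiv n d) ↔ ∀ i, d i < m := by
  simp only [IsSlim, coe_differencesEquiv]
  constructor
  · rintro ⟨h₁, h₂⟩ ⟨i, hi⟩
    rcases Nat.lt_or_ge (i + 1) n with h | h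
    · have := h₁ ⟨i, hi⟩ ⟨i + 1, h⟩ rfl
      rw [Fin.accumulate_rec hi h] at this
      omega
    · have hn : n = i + 1 := by omega
      have := h₂ ⟨i, hi⟩ hn.symm
      rwa [Fin.accumulate_last hi hn d fun j hj => absurd j.2 (by omega)] at this
  · intro h
    constructor
    · rintro ⟨i, hi⟩ ⟨j, hj⟩ hij
      obtain rfl : i + 1 = j := hij
      rw [Fin.accumulate_rec hi hj]
      have := h ⟨i, hi⟩
      omega
    · rintro ⟨i, hi⟩ hin
      rw [Fin.accumulate_last hi hin.symm d fun j hj => absurd j.2 (by have : i + 1 = n := hin; omega)]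
      exact h _

/-- Slim partitions are those with small successive differences. -/
def slimEquiv (n m : ℕ) : SlimPtn n m ≃ (Fin n → Fin m) :=
  ((differencesEquiv n).subtypeEquiv fun d => (isSlim_differencesEquiv (m := m) d).symm).symm.trans
    { toFun := fun d i => ⟨d.1 i, d.2 i⟩
      invFun := fun d => ⟨fun i => d i, fun i => (d i).2⟩
      left_inv := fun _ => rfl
      right_inv := fun _ => rfl }

instance : Finite (SlimPtn n m) := Finite.of_equiv _ (slimEquiv n m).symm

lemma card_slimPtn (n m : ℕ) : Nat.card (SlimPtn n m) = m ^ n := by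
  rw [Nat.card_congr (slimEquiv n m)]
  simp

/-- Euclidean division by `m` of each successive difference; accumulation is additive. -/
lemma exists_eq_smul_add_slim (hm : 0 < m) (l : Ptn n) :
    ∃ (ν : Ptn n) (μ : SlimPtn n m), l.1 = m • ν.1 + μ.1.1 := by
  obtain ⟨d, rfl⟩ := (differencesEquiv n).surjective l
  refine ⟨differencesEquiv n fun i => d i / m, ⟨differencesEquiv n fun i => d i % m,
    (isSlim_differencesEquiv _).2 fun i => Nat.mod_lt _ hm⟩, ?_⟩
  simp only [coe_differencesEquiv]
  rw [← map_nsmul, ← map_add]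
  congr 1
  funext i
  simp [Nat.div_add_mod]

lemma slim_unique (ν ν' : Ptn n) (μ μ' : SlimPtn n m)
    (h : m • ν.1 + μ.1.1 = m • ν'.1 + μ'.1.1) : μ = μ' := by
  obtain ⟨d, rfl⟩ := (differencesEquiv n).surjective ν
  obtain ⟨d', rfl⟩ := (differencesEquiv n).surjective ν'
  obtain ⟨μ, s⟩ := μ
  obtain ⟨μ', s'⟩ := μ'
  obtain ⟨e, rfl⟩ := (differencesEquiv n).surjective μ
  obtain ⟨e', rfl⟩ := (differencesEquiv n).surjective μ'
  rw [isSlim_differencesEquiv] at s s'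
  simp only [coe_differencesEquiv] at h
  rw [← map_nsmul, ← map_add, ← map_nsmul, ← map_add] at h
  refine Subtype.ext (congrArg (differencesEquiv n) (_root_.funext fun i => ?_))
  have := congrFun (Fin.accumulate_injective le_rfl h) i
  simp only [Pi.add_apply, Pi.smul_apply, smul_eq_mul] at this
  have := congrArg (· % m) this
  simpa [Nat.mul_add_mod, Nat.mod_eq_of_lt (s i), Nat.mod_eq_of_lt (s' i)] using this

end Partitions

/-! ### Lexicographic leading exponents and freeness over the Frobenius image -/

section LexDegree

open AddMonoidAlgebra (supDegree leadingCoeff leadingCoeff_ne_zero sum_ne_zero_of_injOn_supDegree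
  supDegree_sub_lt_of_leadingCoeff_eq)

variable {n m : ℕ}

lemma monomialSymm_isSymmetric (l : Ptn n) : (monomialSymm l).IsSymmetric := by
  intro e
  unfold monomialSymm
  rw [map_sum]
  refine Finset.sum_nbij' (fun a => a ∘ e.symm) (fun a => a ∘ e) ?_ ?_ ?_ ?_ ?_
  · simp only [Finset.mem_image, Finset.mem_univ, true_and]
    rintro _ ⟨w, rfl⟩
    exact ⟨e.symm.trans w, by ext; simp⟩
  · simp only [Finset.mem_image, Finset.mem_univ, true_and]
    rintro _ ⟨w, rfl⟩
    exact ⟨e.trans w, by ext; simp⟩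
  · intro a _; ext; simp
  · intro a _; ext; simp
  · intro a _
    rw [rename_monomial]
    congr 2
    ext i
    simp [Finsupp.mapDomain_equiv_apply]

lemma coeff_monomialSymm_ne_zero {l : Ptn n} {a : Fin n →₀ ℕ} (h : coeff a (monomialSymm l) ≠ 0) :
    ∃ w : Equiv.Perm (Fin n), ⇑a = l.1 ∘ w := by
  unfold monomialSymm at h
  rw [coeff_sum] at h
  obtain ⟨b, hb, hne⟩ := Finset.exists_ne_zero_of_sum_ne_zero h
  obtain ⟨w, -, rfl⟩ := Finset.mem_image.mp hb
  refine ⟨w, ?_⟩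
  rw [coeff_monomial] at hne
  have : Finsupp.equivFunOnFinite.symm (l.1 ∘ w) = a := by
    by_contra h'
    simp [h'] at hne
  rw [← this]
  rfl

lemma coeff_monomialSymm_self (l : Ptn n) :
    coeff (Finsupp.equivFunOnFinite.symm l.1) (monomialSymm l) = 1 := by
  unfold monomialSymm
  simp only [coeff_sum, coeff_monomial, EmbeddingLike.apply_eq_iff_eq]
  rw [Finset.sum_ite_eq']
  exact if_pos (Finset.mem_image.mpr ⟨1, Finset.mem_univ _, rfl⟩)

/-- Sorted rearrangements are unique; `Fin.rev` passes from antitone to monotone. -/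
lemma antitone_comp_perm_eq {a b : Fin n → ℕ} (ha : Antitone a) (hb : Antitone b)
    (w : Equiv.Perm (Fin n)) (h : a = b ∘ w) : a = b := by
  have key : ∀ c : Fin n → ℕ, Antitone c → c ∘ Fin.rev = c ∘ Fin.revPerm ∧
      Monotone (c ∘ Fin.revPerm) := fun c hc =>
    ⟨rfl, fun i j hij => hc (Fin.rev_le_rev.mpr hij)⟩
  have h1 := Tuple.unique_monotone (f := a) (σ := Fin.revPerm) (τ := w.symm * Fin.revPerm)
    (key a ha).2 (by
      have : a ∘ (w.symm * Fin.revPerm : Equiv.Perm (Fin n)) = b ∘ Fin.revPerm := by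
        subst h; ext i; simp
      rw [this]
      exact (key b hb).2)
  have h2 : a ∘ (w.symm * Fin.revPerm : Equiv.Perm (Fin n)) = b ∘ Fin.revPerm := by
    subst h; ext i; simp
  rw [h2] at h1
  exact Fin.revPerm.surjective.injective_comp_right h1

/-- At the first index where the two differ, the earlier partial sums agree, so the dominance
inequality there compares the entries themselves. -/
lemma DomLT.toLex_le {ν μ : Ptn n} (h : DomLT ν μ) :
    toLex (Finsupp.equivFunOnFinite.symm ν.1) ≤ toLex (Finsupp.equivFunOnFinite.symm μ.1) := by
  by_contra hlt
  obtain ⟨i, hi, hi'⟩ := not_le.mp hlt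
  simp only [ofLex_toLex, Finsupp.equivFunOnFinite_symm_apply_apply] at hi hi'
  have := h.2.2 i
  rw [← Finset.Iio_insert i, Finset.sum_insert (by simp), Finset.sum_insert (by simp)] at this
  have h2 : ∑ x ∈ Finset.Iio i, ν.1 x = ∑ x ∈ Finset.Iio i, μ.1 x :=
    Finset.sum_congr rfl fun j hj => (hi j (Finset.mem_Iio.mp hj)).symm
  omega

lemma coeff_le_supDegree {p : MvPolynomial (Fin n) ℂ} {a : Fin n →₀ ℕ} (h : coeff a p ≠ 0) :
    toLex a ≤ supDegree toLex p :=
  Finset.le_sup (f := toLex) (Finsupp.mem_support_iff.2 h)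

lemma coeff_supDegree_ne_zero {p : MvPolynomial (Fin n) ℂ} (h : p ≠ 0) :
    coeff (ofLex (supDegree toLex p)) p ≠ 0 := by
  rw [← leadingCoeff_toLex]
  exact (leadingCoeff_ne_zero toLex.injective).2 h

/-- The partition formed by the highest exponent of a symmetric polynomial. -/
def lexPtn {p : MvPolynomial (Fin n) ℂ} (hp : p.IsSymmetric) : Ptn n :=
  ⟨⇑(ofLex (supDegree toLex p)), hp.antitone_supDegree⟩

lemma supDegree_expand (hm : 0 < m) {p : MvPolynomial (Fin n) ℂ} (hp : p ≠ 0) :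
    supDegree toLex (expand m p) = toLex (m • ofLex (supDegree toLex p)) := by
  classical
  refine le_antisymm ?_ (coeff_le_supDegree ?_)
  · have h := coeff_supDegree_ne_zero ((expand_ne_zero hm).2 hp)
    rw [← mem_support_iff, support_expand _ hm.ne'] at h
    obtain ⟨a, ha, hae⟩ := Finset.mem_image.mp h
    have : supDegree toLex (expand m p) = toLex (m • a) := by rw [hae]; rfl
    rw [this]
    have h2 : toLex a ≤ supDegree toLex p := coeff_le_supDegree (mem_support_iff.mp ha)
    exact nsmul_le_nsmul_right h2 m
  · rw [coeff_expand_smul _ hm.ne']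
    exact coeff_supDegree_ne_zero hp

lemma hasHighestPtn_monomialSymm (l : Ptn n) : HasHighestPtn (monomialSymm l) l := by
  refine ⟨Finsupp.single l 1, by simp, fun ν hν => Or.inl ?_, by simp⟩
  exact Finset.mem_singleton.mp (Finsupp.support_single_subset hν)

lemma HasHighestPtn.isSymmetric {f : MvPolynomial (Fin n) ℂ} {μ : Ptn n} (h : HasHighestPtn f μ) :
    f.IsSymmetric := by
  obtain ⟨c, -, -, rfl⟩ := h
  exact (symmetricSubalgebra (Fin n) ℂ).sum_mem fun ν _ =>
    (symmetricSubalgebra (Fin n) ℂ).smul_mem (monomialSymm_isSymmetric ν) _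

lemma HasHighestPtn.coeff_ne_zero {f : MvPolynomial (Fin n) ℂ} {μ : Ptn n}
    (h : HasHighestPtn f μ) : coeff (Finsupp.equivFunOnFinite.symm μ.1) f ≠ 0 := by
  obtain ⟨c, hc, -, rfl⟩ := h
  rw [Finsupp.sum, coeff_sum, Finset.sum_eq_single_of_mem μ (Finsupp.mem_support_iff.2 hc)]
  · rwa [coeff_smul, coeff_monomialSymm_self, smul_eq_mul, mul_one]
  · intro ν _ hν
    rw [coeff_smul]
    by_contra hne
    obtain ⟨w, hw⟩ := coeff_monomialSymm_ne_zero (right_ne_zero_of_smul hne)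
    exact hν (Subtype.ext (antitone_comp_perm_eq μ.2 ν.2 w hw).symm)

lemma HasHighestPtn.ne_zero {f : MvPolynomial (Fin n) ℂ} {μ : Ptn n} (h : HasHighestPtn f μ) :
    f ≠ 0 := by
  rintro rfl
  exact h.coeff_ne_zero (coeff_zero _)

/-- The leading exponent of a symmetric polynomial is antitone, so it is one of the partitions in
the expansion, and all of these are lexicographically at most `μ`. -/
lemma HasHighestPtn.supDegree_eq {f : MvPolynomial (Fin n) ℂ} {μ : Ptn n} (h : HasHighestPtn f μ) :
    supDegree toLex f = toLex (Finsupp.equivFunOnFinite.symm μ.1) := by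
  refine le_antisymm ?_ (coeff_le_supDegree h.coeff_ne_zero)
  have hne := coeff_supDegree_ne_zero h.ne_zero
  have hanti := h.isSymmetric.antitone_supDegree
  obtain ⟨c, hc, hdom, hf⟩ := h
  have h1 : coeff (ofLex (supDegree toLex f))
      (c.sum fun ν a => a • monomialSymm ν) ≠ 0 := by rwa [← hf]
  rw [Finsupp.sum, coeff_sum] at h1
  obtain ⟨ν, hν, h2⟩ := Finset.exists_ne_zero_of_sum_ne_zero h1
  rw [coeff_smul] at h2
  obtain ⟨w, hw⟩ := coeff_monomialSymm_ne_zero (right_ne_zero_of_smul h2)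
  have h3 : ofLex (supDegree toLex f) = Finsupp.equivFunOnFinite.symm ν.1 :=
    DFunLike.coe_injective (antitone_comp_perm_eq hanti ν.2 w hw)
  have h4 : supDegree toLex f = toLex (Finsupp.equivFunOnFinite.symm ν.1) := by
    rw [← h3]; rfl
  rw [h4]
  rcases hdom ν hν with rfl | h
  · rfl
  · exact h.toLex_le

lemma supDegree_expand_mul (hm : 0 < m) {p g : MvPolynomial (Fin n) ℂ} (hp : p ≠ 0)
    {μ : Ptn n} (hg : HasHighestPtn g μ) :
    supDegree toLex (expand m p * g) =
      toLex (m • ofLex (supDegree toLex p) + Finsupp.equivFunOnFinite.symm μ.1) := by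
  have hp' := (expand_ne_zero hm).2 hp
  rw [AddMonoidAlgebra.supDegree_mul toLex.injective (fun _ _ => rfl) _ hp' hg.ne_zero,
    supDegree_expand hm hp, hg.supDegree_eq]
  · rfl
  · exact mul_ne_zero ((leadingCoeff_ne_zero toLex.injective).2 hp')
      ((leadingCoeff_ne_zero toLex.injective).2 hg.ne_zero)

/-- Nonzero summands have distinct leading exponents, since the slim remainder of the exponent
recovers `μ`; they cannot cancel. -/
lemma eq_zero_of_sum_expand_mul_eq_zero [Fintype (SlimPtn n m)] (hm : 0 < m)
    {g : SlimPtn n m → MvPolynomial (Fin n) ℂ} (hg : ∀ μ, HasHighestPtn (g μ) μ.1)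
    {p : SlimPtn n m → MvPolynomial (Fin n) ℂ} (hp : ∀ μ, (p μ).IsSymmetric)
    (h : ∑ μ, expand m (p μ) * g μ = 0) : p = 0 := by
  classical
  by_contra hne
  have hS : (Finset.univ.filter fun μ => p μ ≠ 0).Nonempty := by
    by_contra hS
    rw [Finset.not_nonempty_iff_eq_empty, Finset.filter_eq_empty_iff] at hS
    exact hne (_root_.funext fun μ => not_not.mp (hS (Finset.mem_univ μ)))
  refine sum_ne_zero_of_injOn_supDegree (D := toLex) hS
    (f := fun μ => expand m (p μ) * g μ) ?_ ?_ ?_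
  · intro μ hμ
    exact mul_ne_zero ((expand_ne_zero hm).2 (Finset.mem_filter.mp hμ).2) (hg μ).ne_zero
  · intro μ hμ μ' hμ' he
    have hμ := (Finset.mem_filter.mp (Finset.mem_coe.mp hμ)).2
    have hμ' := (Finset.mem_filter.mp (Finset.mem_coe.mp hμ')).2
    simp only [Function.comp] at he
    rw [supDegree_expand_mul hm hμ (hg μ), supDegree_expand_mul hm hμ' (hg μ')] at he
    refine slim_unique (lexPtn (hp μ)) (lexPtn (hp μ')) μ μ' ?_
    exact congrArg DFunLike.coe (toLex.injective he)
  · refine (Finset.sum_subset (Finset.filter_subset _ _) fun μ _ hμ => ?_).trans h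
    have : p μ = 0 := by
      by_contra h0
      exact hμ (Finset.mem_filter.2 ⟨Finset.mem_univ _, h0⟩)
    simp [this]

lemma eq_of_sum_expand_mul_eq [Fintype (SlimPtn n m)] (hm : 0 < m)
    {g : SlimPtn n m → MvPolynomial (Fin n) ℂ} (hg : ∀ μ, HasHighestPtn (g μ) μ.1)
    {p p' : SlimPtn n m → MvPolynomial (Fin n) ℂ} (hp : ∀ μ, (p μ).IsSymmetric)
    (hp' : ∀ μ, (p' μ).IsSymmetric)
    (h : ∑ μ, expand m (p μ) * g μ = ∑ μ, expand m (p' μ) * g μ) : p = p' := by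
  refine sub_eq_zero.1 (eq_zero_of_sum_expand_mul_eq_zero hm hg (p := p - p')
    (fun μ => (hp μ).sub (hp' μ)) ?_)
  simp only [Pi.sub_apply, map_sub, sub_mul, Finset.sum_sub_distrib, h, sub_self]

/-- Well-founded induction on the leading exponent: if it is `m • ν + μ`, a multiple of `expand m
(monomialSymm ν) * g μ` cancels the leading term. -/
lemma exists_eq_sum_expand_mul [Fintype (SlimPtn n m)] (hm : 0 < m)
    {g : SlimPtn n m → MvPolynomial (Fin n) ℂ} (hg : ∀ μ, HasHighestPtn (g μ) μ.1)
    {f : MvPolynomial (Fin n) ℂ} (hf : f.IsSymmetric) :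
    ∃ p : SlimPtn n m → MvPolynomial (Fin n) ℂ,
      (∀ μ, (p μ).IsSymmetric) ∧ f = ∑ μ, expand m (p μ) * g μ := by
  classical
  induction he : f.supDegree toLex using WellFoundedLT.induction generalizing f with | _ d ih
  subst he
  rcases eq_or_ne f 0 with rfl | h0
  · exact ⟨0, fun _ => IsSymmetric.zero, by simp⟩
  obtain ⟨ν, μ, hl⟩ := exists_eq_smul_add_slim hm (lexPtn hf)
  have hν := hasHighestPtn_monomialSymm ν
  set b := expand m (monomialSymm ν) * g μ with hb
  have hb0 : b ≠ 0 := mul_ne_zero ((expand_ne_zero hm).2 hν.ne_zero) (hg μ).ne_zero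
  have hbs : b.IsSymmetric := IsSymmetric.mul
    (fun e => by rw [rename_expand, monomialSymm_isSymmetric ν e]) (hg μ).isSymmetric
  have hbd : supDegree toLex b = supDegree toLex f := by
    rw [hb, supDegree_expand_mul hm hν.ne_zero (hg μ), hν.supDegree_eq]
    refine ofLex.injective (DFunLike.coe_injective ?_)
    exact hl.symm
  set c := leadingCoeff toLex f / leadingCoeff toLex b with hc
  have hlb : leadingCoeff toLex b ≠ 0 := (leadingCoeff_ne_zero toLex.injective).2 hb0
  have hlf : leadingCoeff toLex f ≠ 0 := (leadingCoeff_ne_zero toLex.injective).2 h0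
  have hc0 : c ≠ 0 := div_ne_zero hlf hlb
  have hcd : supDegree toLex (c • b) = supDegree toLex f := by
    rw [← hbd]
    unfold AddMonoidAlgebra.supDegree
    congr 1
    exact support_smul_eq hc0 b
  have hcl : leadingCoeff toLex f = leadingCoeff toLex (c • b) := by
    rw [leadingCoeff_toLex, leadingCoeff_toLex] at *
    rw [hcd, coeff_smul, hc, hbd, smul_eq_mul, div_mul_cancel₀]
    rwa [hbd] at hlb
  have hadd : ∀ p : SlimPtn n m → MvPolynomial (Fin n) ℂ, (∀ μ, (p μ).IsSymmetric) →
      f - c • b = ∑ μ, expand m (p μ) * g μ → ∃ p : SlimPtn n m → MvPolynomial (Fin n) ℂ,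
      (∀ μ, (p μ).IsSymmetric) ∧ f = ∑ μ, expand m (p μ) * g μ := by
    intro p hp h
    refine ⟨p + Pi.single μ (c • monomialSymm ν), fun μ' => ?_, ?_⟩
    · refine (hp μ').add ?_
      rcases eq_or_ne μ' μ with rfl | hne
      · rw [Pi.single_eq_same]
        exact (monomialSymm_isSymmetric ν).smul c
      · rw [Pi.single_eq_of_ne hne]
        exact IsSymmetric.zero
    · simp only [Pi.add_apply, map_add, add_mul, Finset.sum_add_distrib]
      rw [← h, Finset.sum_eq_single_of_mem μ (Finset.mem_univ _), Pi.single_eq_same, map_smul,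
        smul_mul_assoc, ← hb, sub_add_cancel]
      intro μ' _ hne
      rw [Pi.single_eq_of_ne hne, map_zero, zero_mul]
  rcases supDegree_sub_lt_of_leadingCoeff_eq toLex.injective hcd.symm hcl with hlt | heq
  · obtain ⟨p, hp, h⟩ := ih _ hlt (hf.sub (hbs.smul c)) rfl
    exact hadd p hp h
  · exact hadd 0 (fun _ => IsSymmetric.zero) (by simp [sub_eq_zero.2 heq])

end LexDegree

/-! ### Wheel conditions and twisting by roots of unity -/

section Wheel

variable {n k m r : ℕ}

lemma eval_comp_perm {p : MvPolynomial (Fin n) ℂ} (hp : p.IsSymmetric) (x : Fin n → ℂ)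
    (e : Equiv.Perm (Fin n)) : eval (x ∘ e) p = eval x p := by
  conv_rhs => rw [← hp e, eval_rename]

/-- The point obtained from `z` on replacing the first `k + 1` coordinates by `t ^ i * z 0`. -/
def wheelSubst (h : k < n) (t : ℂ) (z : Fin n → ℂ) (i : Fin n) : ℂ :=
  if (i : ℕ) ≤ k then t ^ (i : ℕ) * z ⟨0, Nat.zero_lt_of_lt h⟩ else z i

lemma wheelSubst_pow (h : k < n) (t : ℂ) (z : Fin n → ℂ) (m : ℕ) :
    wheelSubst h t z ^ m = wheelSubst h (t ^ m) (z ^ m) := by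
  funext i
  simp only [wheelSubst, Pi.pow_apply]
  split_ifs
  · rw [mul_pow, pow_right_comm]
  · rfl

/-- Since `m` is invertible modulo `k + 1`, the map `i ↦ m * i` permutes the residues, that is, the
first `k + 1` indices. -/
lemma exists_perm_wheelSubst (h : k < n) (hm : Nat.Coprime (k + 1) m) {t : ℂ}
    (ht : t ^ (k + 1) = 1) : ∃ e : Equiv.Perm (Fin n), ∀ z,
      wheelSubst h (t ^ m) z = wheelSubst h t z ∘ e := by
  let σ : Fin n → Fin n := fun i => if (i : ℕ) ≤ k
    then ⟨m * i % (k + 1), (Nat.mod_lt _ k.succ_pos).trans_le h⟩ else i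
  have hle : ∀ i : Fin n, m * i % (k + 1) ≤ k := fun i => Nat.le_of_lt_succ (Nat.mod_lt _ k.succ_pos)
  have hσ : Function.Injective σ := by
    intro i j hij
    simp only [σ] at hij
    split_ifs at hij with hi hj hj
    · have h1 : m * i ≡ m * j [MOD k + 1] := Fin.mk.inj_iff.mp hij
      have h2 := Nat.ModEq.cancel_left_of_coprime hm h1
      exact Fin.ext (Nat.ModEq.eq_of_lt_of_lt h2 (Nat.lt_succ_of_le hi) (Nat.lt_succ_of_le hj))
    · exact absurd (hij ▸ hle i) hj
    · exact absurd (hij ▸ hle j) hi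
    · exact hij
  refine ⟨Equiv.ofBijective σ (Finite.injective_iff_bijective.mp hσ), fun z => _root_.funext fun i => ?_⟩
  simp only [wheelSubst, Function.comp, Equiv.ofBijective_apply, σ]
  by_cases hi : (i : ℕ) ≤ k
  · simp only [if_pos hi, if_pos (hle i)]
    rw [← pow_mul, pow_eq_pow_mod _ ht]
  · simp only [if_neg hi]

lemma eval_wheelSubst_pow (h : k < n) (hm : Nat.Coprime (k + 1) m) {t : ℂ} (ht : t ^ (k + 1) = 1)
    {p : MvPolynomial (Fin n) ℂ} (hp : p.IsSymmetric) (z : Fin n → ℂ) :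
    eval (wheelSubst h (t ^ m) z) p = eval (wheelSubst h t z) p := by
  obtain ⟨e, he⟩ := exists_perm_wheelSubst h hm ht
  rw [he, eval_comp_perm hp]

lemma onWheel_two_iff {t : ℂ} {x : Fin n → ℂ} :
    OnWheel n k 2 t 1 x ↔ ∃ h : k < n, wheelSubst h t x = x := by
  refine exists_congr fun h => ?_
  rw [funext_iff]
  refine forall_congr' fun i => ?_
  simp only [one_pow, mul_one, wheelSubst]
  constructor
  · intro hi
    split_ifs with hik
    · rcases Nat.eq_zero_or_pos i with h0 | h0
      · rw [h0, pow_zero, one_mul]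
        congr 1
        exact Fin.ext h0.symm
      · obtain ⟨_, _, h1⟩ := hi h0 hik
        exact h1.symm
    · rfl
  · intro hi _ hik
    rw [if_pos hik] at hi
    exact ⟨0, by norm_num, hi.symm⟩

lemma mem_wheelSpace_two_iff {t : ℂ} {p : MvPolynomial (Fin n) ℂ} :
    p ∈ wheelSpace n k 2 t 1 ↔
      p.IsSymmetric ∧ ∀ (h : k < n) (z : Fin n → ℂ), eval (wheelSubst h t z) p = 0 := by
  refine and_congr_right fun _ => ⟨fun hp h z => hp _ (onWheel_two_iff.2 ⟨h, ?_⟩), fun hp x hx => ?_⟩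
  · funext i
    simp only [wheelSubst]
    split_ifs <;> simp
  · obtain ⟨h, hx⟩ := onWheel_two_iff.1 hx
    rw [← hx]
    exact hp h x

lemma OnWheel.pow {t q : ℂ} (hq : q ^ (r - 1) = 1) {x : Fin n → ℂ} (hx : OnWheel n k r t q x) :
    ∃ h : k < n, x ^ (r - 1) = wheelSubst h (t ^ (r - 1)) (x ^ (r - 1)) := by
  obtain ⟨h, hx⟩ := hx
  refine ⟨h, _root_.funext fun i => ?_⟩
  simp only [wheelSubst, Pi.pow_apply]
  split_ifs with hik
  · rcases Nat.eq_zero_or_pos i with h0 | h0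
    · rw [h0, pow_zero, one_mul]
      congr 2
      exact Fin.ext h0
    · obtain ⟨s, _, h1⟩ := hx i h0 hik
      rw [h1, mul_pow, mul_pow, pow_right_comm q, hq, one_pow, mul_one, pow_right_comm]
  · rfl

lemma expand_mul_mem_wheelSpace (hkr : Nat.Coprime (k + 1) (r - 1)) {t q : ℂ}
    (ht : t ^ (k + 1) = 1) (hq : q ^ (r - 1) = 1) {p g : MvPolynomial (Fin n) ℂ}
    (hp : p ∈ wheelSpace n k 2 t 1) (hg : g.IsSymmetric) :
    expand (r - 1) p * g ∈ wheelSpace n k r t q := by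
  rw [mem_wheelSpace_two_iff] at hp
  refine ⟨IsSymmetric.mul (fun e => by rw [rename_expand, hp.1 e]) hg, fun x hx => ?_⟩
  obtain ⟨h, hx⟩ := hx.pow hq
  rw [map_mul, eval_expand, hx, eval_wheelSubst_pow h hkr ht hp.1, hp.2 h, zero_mul]

lemma OnWheel.root_mul {t q : ℂ} (hq : q ^ (r - 1) = 1) {x : Fin n → ℂ}
    (hx : OnWheel n k r t q x) (s : Fin n → Fin (r - 1)) :
    OnWheel n k r t q (fun i => q ^ (s i : ℕ) * x i) := by
  obtain ⟨h, hx⟩ := hx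
  refine ⟨h, fun i h0 hik => ?_⟩
  obtain ⟨a, _, h1⟩ := hx i h0 hik
  set o : Fin n := ⟨0, Nat.zero_lt_of_lt h⟩
  -- The reference coordinate `x o` is twisted too, so its exponent `s o` is subtracted modulo `r -
  -- 1`.
  refine ⟨(s i + a + (r - 1 - s o)) % (r - 1), Nat.mod_lt _ (by omega), ?_⟩
  have h2 : q ^ (r - 1 - (s o : ℕ)) * q ^ (s o : ℕ) = 1 := by
    rw [← pow_add, Nat.sub_add_cancel (s o).2.le, hq]
  beta_reduce
  rw [← pow_eq_pow_mod _ hq, h1, pow_add, pow_add]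
  linear_combination (-(t ^ (i : ℕ) * q ^ (s i : ℕ) * q ^ a * x o)) * h2

lemma prod_X_sub_C_isSymmetric (c : ℂ) :
    (∏ j : Fin n, (X j - C c) : MvPolynomial (Fin n) ℂ).IsSymmetric := by
  intro e
  rw [map_prod]
  simp only [map_sub, rename_X, rename_C]
  exact Equiv.prod_comp e fun j => (X j - C c : MvPolynomial (Fin n) ℂ)

/-- Symmetric polynomials separate the points obtained from a general point by multiplying its
coordinates by roots of unity. -/
lemma exists_symmetric_separating {q : ℂ} (hq : IsPrimitiveRoot q m) {x : Fin n → ℂ}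
    (hx : ∀ i, x i ≠ 0) (hinj : Function.Injective (x ^ m)) (s₀ : Fin n → Fin m) :
    ∃ H : MvPolynomial (Fin n) ℂ, H.IsSymmetric ∧
      eval (fun i => q ^ (s₀ i : ℕ) * x i) H ≠ 0 ∧
      ∀ s : Fin n → Fin m, s ≠ s₀ → eval (fun i => q ^ (s i : ℕ) * x i) H = 0 := by
  classical
  -- The factor for `(i, a)` vanishes exactly when some coordinate equals `q ^ a * x i`. At a twist
  -- of `x` that coordinate must be the `i`-th, because the `m`-th powers are distinct.
  refine ⟨∏ i, ∏ a ∈ Finset.univ.erase (s₀ i), ∏ j, (X j - C (q ^ (a : ℕ) * x i)), ?_, ?_, ?_⟩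
  · exact (symmetricSubalgebra (Fin n) ℂ).prod_mem fun i _ =>
      (symmetricSubalgebra (Fin n) ℂ).prod_mem fun a _ => prod_X_sub_C_isSymmetric _
  · simp only [map_prod, map_sub, eval_X, eval_C]
    refine Finset.prod_ne_zero_iff.2 fun i _ => Finset.prod_ne_zero_iff.2 fun a ha =>
      Finset.prod_ne_zero_iff.2 fun j _ => sub_ne_zero.2 fun h => ?_
    have hij : j = i := by
      apply hinj
      have := congrArg (· ^ m) h
      simpa only [Pi.pow_apply, mul_pow, pow_right_comm q, hq.pow_eq_one, one_pow, one_mul] using this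
    subst hij
    have := hq.pow_inj (s₀ j).2 a.2 (mul_right_cancel₀ (hx j) h)
    exact (Finset.mem_erase.mp ha).1 (Fin.ext this.symm)
  · intro s hs
    obtain ⟨i, hi⟩ := Function.ne_iff.mp hs
    simp only [map_prod, map_sub, eval_X, eval_C]
    refine Finset.prod_eq_zero (Finset.mem_univ i) (Finset.prod_eq_zero
      (Finset.mem_erase.2 ⟨hi, Finset.mem_univ _⟩) (Finset.prod_eq_zero (Finset.mem_univ i) ?_))
    exact sub_self _

/-- Expanding the separating polynomials in the `g μ` gives a right inverse of the matrix of values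
of the `g μ` at the twisted points. The matrix is square, as there are `m ^ n` slim partitions, so
this is also a left inverse. -/
lemma eval_pow_eq_zero_of_sum_expand_mul [Fintype (SlimPtn n m)] {q : ℂ} (hm : 0 < m)
    (hq : IsPrimitiveRoot q m) {g : SlimPtn n m → MvPolynomial (Fin n) ℂ}
    (hg : ∀ μ, HasHighestPtn (g μ) μ.1) (p : SlimPtn n m → MvPolynomial (Fin n) ℂ)
    {x : Fin n → ℂ} (hx : ∀ i, x i ≠ 0) (hinj : Function.Injective (x ^ m))
    (h : ∀ s : Fin n → Fin m,
      eval (fun i => q ^ (s i : ℕ) * x i) (∑ μ, expand m (p μ) * g μ) = 0) (μ : SlimPtn n m) :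
    eval (x ^ m) (p μ) = 0 := by
  classical
  have hpow : ∀ s : Fin n → Fin m, (fun i => q ^ (s i : ℕ) * x i) ^ m = x ^ m := by
    intro s
    funext i
    simp only [Pi.pow_apply]
    rw [mul_pow, pow_right_comm, hq.pow_eq_one, one_pow, one_mul]
  have heval : ∀ (b : SlimPtn n m → MvPolynomial (Fin n) ℂ) (s : Fin n → Fin m),
      eval (fun i => q ^ (s i : ℕ) * x i) (∑ μ, expand m (b μ) * g μ) =
        ∑ μ, eval (fun i => q ^ (s i : ℕ) * x i) (g μ) * eval (x ^ m) (b μ) := by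
    intro b s
    rw [map_sum]
    refine Finset.sum_congr rfl fun μ _ => ?_
    rw [map_mul, eval_expand, hpow, mul_comm]
  choose H hHs hH1 hH0 using exists_symmetric_separating hq hx hinj
  choose b _ hb using fun s₀ => exists_eq_sum_expand_mul hm hg (hHs s₀)
  let M : Matrix (Fin n → Fin m) (SlimPtn n m) ℂ := fun s μ =>
    eval (fun i => q ^ (s i : ℕ) * x i) (g μ)
  let N : Matrix (SlimPtn n m) (Fin n → Fin m) ℂ := fun μ s => eval (x ^ m) (b s μ) *
    (eval (fun i => q ^ (s i : ℕ) * x i) (H s))⁻¹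
  have hMN : M * N = 1 := by
    ext s s₀
    have h1 : (M * N) s s₀ = eval (fun i => q ^ (s i : ℕ) * x i) (H s₀) *
        (eval (fun i => q ^ (s₀ i : ℕ) * x i) (H s₀))⁻¹ := by
      conv_rhs => enter [1]; rw [hb s₀, heval]
      rw [Matrix.mul_apply, Finset.sum_mul]
      exact Finset.sum_congr rfl fun μ _ => (mul_assoc _ _ _).symm
    rw [h1]
    rcases eq_or_ne s s₀ with rfl | hne
    · rw [mul_inv_cancel₀ (hH1 s), Matrix.one_apply_eq]
    · rw [hH0 s₀ s hne, zero_mul, Matrix.one_apply_ne hne]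
  have hNM : N * M = 1 := (Matrix.mul_eq_one_comm_of_equiv (slimEquiv n m).symm).1 hMN
  have hM : M.mulVec (fun μ => eval (x ^ m) (p μ)) = 0 := by
    funext s
    exact (heval p s).symm.trans (h s)
  have := congrArg (N.mulVec) hM
  rw [Matrix.mulVec_mulVec, hNM, Matrix.one_mulVec, Matrix.mulVec_zero] at this
  exact congrFun this μ

/-- The value is a polynomial in `z`. Its product with the polynomial `D` detecting zero or repeated
coordinates vanishes identically, and `D ≠ 0`. -/
lemma eval_wheelSubst_eq_zero (h : k < n) {t : ℂ} (ht : IsPrimitiveRoot t (k + 1))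
    {p : MvPolynomial (Fin n) ℂ}
    (hp : ∀ z, (∀ i, wheelSubst h t z i ≠ 0) → Function.Injective (wheelSubst h t z) →
      eval (wheelSubst h t z) p = 0) (z : Fin n → ℂ) :
    eval (wheelSubst h t z) p = 0 := by
  classical
  let o : Fin n := ⟨0, Nat.zero_lt_of_lt h⟩
  let Y : Fin n → MvPolynomial (Fin n) ℂ := fun i =>
    if (i : ℕ) ≤ k then C (t ^ (i : ℕ)) * X o else X i
  have hY : ∀ z i, eval z (Y i) = wheelSubst h t z i := by
    intro z i
    simp only [Y, wheelSubst]
    split_ifs <;> simp [o]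
  have hP : ∀ z, eval z (bind₁ Y p) = eval (wheelSubst h t z) p := by
    intro z
    change eval₂Hom _ _ _ = _
    rw [eval₂Hom_bind₁]
    change eval (fun i => eval z (Y i)) p = _
    simp only [hY]
  let D : MvPolynomial (Fin n) ℂ :=
    (∏ i, Y i) * ∏ i, ∏ j ∈ Finset.univ.erase i, (Y i - Y j)
  have hD : ∀ z, eval z D ≠ 0 ↔
      (∀ i, wheelSubst h t z i ≠ 0) ∧ Function.Injective (wheelSubst h t z) := by
    intro z
    simp only [D, map_mul, map_prod, map_sub, hY, mul_ne_zero_iff, Finset.prod_ne_zero_iff,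
      Finset.mem_univ, true_imp_iff, Finset.mem_erase, and_true, sub_ne_zero]
    refine and_congr_right fun _ => ⟨fun hi i j hij => ?_, fun hi i j hji hij => hji (hi hij).symm⟩
    by_contra hne
    exact hi i j (Ne.symm hne) hij
  have hD0 : D ≠ 0 := by
    intro h0
    -- At this point the wheel coordinates are the distinct powers of `t`, of modulus 1; the others
    -- are distinct reals greater than 1.
    refine ((hD fun i => ((i : ℕ) + 1 : ℝ)).2 ⟨?_, ?_⟩) (by rw [h0, map_zero])
    · intro i
      simp only [wheelSubst]
      split_ifs
      · simp [ht.ne_zero]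
      · exact Complex.ofReal_ne_zero.2 (Nat.cast_add_one_ne_zero _)
    · have hn : ‖t‖ = 1 := ht.norm'_eq_one k.succ_ne_zero
      intro i j hij
      simp only [wheelSubst] at hij
      have key : ∀ a b : Fin n, (b : ℕ) ≠ 0 →
          t ^ (a : ℕ) * (((0 : ℕ) + 1 : ℝ) : ℂ) ≠ (((b : ℕ) + 1 : ℝ) : ℂ) := by
        intro a b hb hab
        have := congrArg norm hab
        rw [norm_mul, norm_pow, hn, Complex.norm_real, Complex.norm_real, Real.norm_of_nonneg
          (by positivity), Real.norm_of_nonneg (by positivity)] at this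
        norm_num at this
        exact hb this
      split_ifs at hij with hi hj hj
      · have : t ^ (i : ℕ) = t ^ (j : ℕ) := by simpa using hij
        exact Fin.ext (ht.pow_inj (Nat.lt_succ_of_le hi) (Nat.lt_succ_of_le hj) this)
      · exact absurd hij (key i j (by omega))
      · exact absurd hij.symm (key j i (by omega))
      · apply Fin.ext
        have : ((i : ℕ) : ℂ) = ((j : ℕ) : ℂ) := by simpa using hij
        exact_mod_cast this
  have hPD : bind₁ Y p * D = 0 := by
    refine MvPolynomial.funext fun z => ?_
    rw [map_mul, map_zero, hP]
    by_cases hz : eval z D = 0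
    · rw [hz, mul_zero]
    · obtain ⟨h1, h2⟩ := (hD z).1 hz
      rw [hp z h1 h2, zero_mul]
  rw [← hP, (mul_eq_zero.mp hPD).resolve_right hD0, map_zero]

lemma mem_wheelSpace_of_sum_expand_mul_mem [Fintype (SlimPtn n (r - 1))] (hr : 2 ≤ r)
    (hkr : Nat.Coprime (k + 1) (r - 1)) {t q : ℂ} (ht : IsPrimitiveRoot t (k + 1))
    (hq : IsPrimitiveRoot q (r - 1)) {g : SlimPtn n (r - 1) → MvPolynomial (Fin n) ℂ}
    (hg : ∀ μ, HasHighestPtn (g μ) μ.1) {p : SlimPtn n (r - 1) → MvPolynomial (Fin n) ℂ}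
    (hp : ∀ μ, (p μ).IsSymmetric)
    (h : ∑ μ, expand (r - 1) (p μ) * g μ ∈ wheelSpace n k r t q) (μ : SlimPtn n (r - 1)) :
    p μ ∈ wheelSpace n k 2 t 1 := by
  have hm : 0 < r - 1 := by omega
  refine mem_wheelSpace_two_iff.2 ⟨hp μ, fun hk => eval_wheelSubst_eq_zero hk ht fun z h0 hi => ?_⟩
  -- The wheel point built from `m`-th roots of the `z i`, where `m = r - 1`, has as its `m`-th
  -- power a permutation of the wheel point of `z`, so the genericity of the latter carries over.
  choose w hw using fun i => IsAlgClosed.exists_pow_nat_eq (z i) hm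
  obtain rfl : w ^ (r - 1) = z := _root_.funext hw
  obtain ⟨e, he⟩ := exists_perm_wheelSubst hk hkr ht.pow_eq_one
  have hx := wheelSubst_pow hk t w (r - 1)
  rw [← eval_wheelSubst_pow hk hkr ht.pow_eq_one (hp μ), ← hx]
  refine eval_pow_eq_zero_of_sum_expand_mul hm hq hg p (fun i hi0 => ?_) ?_ (fun s => ?_) μ
  · refine h0 (e i) ?_
    have := congrFun (hx.trans (he _)) i
    rw [Pi.pow_apply, hi0, zero_pow hm.ne'] at this
    exact this.symm
  · rw [hx, he]
    exact hi.comp e.injective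
  · refine h.2 _ (OnWheel.root_mul hq.pow_eq_one ⟨hk, fun i hi0 hik => ⟨0, hm, ?_⟩⟩ s)
    simp [wheelSubst, hik]

end Wheel

/-! ### Dimension of `F_n^{(k,2)}` -/

section Basis

variable {n k : ℕ}

lemma infinite_admissiblePtn (hn : 0 < n) (hk : 1 ≤ k) : Infinite (AdmissiblePtn n k) := by
  -- Strictly decreasing, so each part occurs at most once, which is admissible because `1 ≤ k`.
  let l : ℕ → Ptn n := fun a => ⟨fun i => a + (n - i), fun i j hij => by
    have : (i : ℕ) ≤ j := hij
    dsimp only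
    omega⟩
  refine Infinite.of_injective (fun a => (⟨l a, fun b => ?_⟩ : AdmissiblePtn n k)) ?_
  · refine le_trans (Finset.card_le_one.2 fun i hi j hj => Fin.ext ?_) hk
    have h1 : a + (n - i) = b := (Finset.mem_filter.mp hi).2
    have h2 : a + (n - j) = b := (Finset.mem_filter.mp hj).2
    omega
  · intro a b hab
    have h : a + (n - 0) = b + (n - 0) :=
      congrFun (congrArg (fun l : AdmissiblePtn n k => l.1.1) hab) ⟨0, hn⟩
    omega

lemma mul_mem_wheelSpace {r : ℕ} {t q : ℂ} {e f : MvPolynomial (Fin n) ℂ} (he : e.IsSymmetric)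
    (hf : f ∈ wheelSpace n k r t q) : e * f ∈ wheelSpace n k r t q :=
  ⟨IsSymmetric.mul he hf.1, fun x hx => by rw [map_mul, hf.2 x hx, mul_zero]⟩

/-- The product of the `x_i - t x_j` over all ordered pairs satisfies the wheel condition. -/
lemma exists_ne_zero_mem_wheelSpace_two (hk : 1 ≤ k) {t : ℂ} :
    ∃ f ∈ wheelSpace n k 2 t 1, f ≠ 0 := by
  classical
  refine ⟨∏ i, ∏ j ∈ Finset.univ.erase i, (X i - C t * X j), ⟨?_, ?_⟩, ?_⟩
  · intro e
    simp only [map_prod, map_sub, map_mul, rename_X, rename_C]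
    rw [← Equiv.prod_comp e fun i => ∏ j ∈ Finset.univ.erase i,
      (X i - C t * X j : MvPolynomial (Fin n) ℂ)]
    refine Finset.prod_congr rfl fun i _ => ?_
    refine Finset.prod_bij' (fun j _ => e j) (fun j _ => e.symm j) ?_ ?_ ?_ ?_ ?_
    · simp
    · simp [Equiv.symm_apply_eq]
    · simp
    · simp
    · simp
  · rintro x ⟨h, hx⟩
    have hn : 1 < n := by omega
    obtain ⟨s, -, h1⟩ := hx ⟨1, hn⟩ Nat.one_pos hk
    simp only [map_prod, map_sub, map_mul, eval_X, eval_C]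
    -- As `1 ≤ k`, the wheel condition makes the second coordinate `t` times the first.
    refine Finset.prod_eq_zero (Finset.mem_univ ⟨1, hn⟩)
      (Finset.prod_eq_zero (i := ⟨0, Nat.zero_lt_of_lt hn⟩) (by simp [Fin.ext_iff]) ?_)
    rw [h1]
    simp
  · refine Finset.prod_ne_zero_iff.2 fun i _ => Finset.prod_ne_zero_iff.2 fun j hj h => ?_
    have hji := (Finset.mem_erase.mp hj).1
    have := congrArg (eval (Pi.single i 1)) h
    simp [hji] at this

/-- Otherwise multiplication by `x_1 ⋯ x_n` would have an eigenvalue on this nonzero space, and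
cancelling an eigenvector would make `x_1 ⋯ x_n` constant. -/
lemma not_finite_wheelSpace_two (hn : 0 < n) (hk : 1 ≤ k) {t : ℂ} :
    ¬ Module.Finite ℂ (wheelSpace n k 2 t 1) := by
  intro hfin
  obtain ⟨f, hf, hf0⟩ := exists_ne_zero_mem_wheelSpace_two (n := n) hk (t := t)
  have : Nontrivial (wheelSpace n k 2 t 1) :=
    ⟨⟨⟨f, hf⟩, 0, fun h => hf0 (congrArg Subtype.val h)⟩⟩
  have hX := prod_X_sub_C_isSymmetric (n := n) 0
  let T : Module.End ℂ (wheelSpace n k 2 t 1) :=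
    (LinearMap.mulLeft ℂ (∏ j : Fin n, (X j - C (0 : ℂ)))).restrict
      fun f hf => mul_mem_wheelSpace hX hf
  obtain ⟨c, hc⟩ := Module.End.exists_eigenvalue T
  obtain ⟨v, hv⟩ := hc.exists_hasEigenvector
  have h1 : (∏ j : Fin n, (X j - C (0 : ℂ))) * (v : MvPolynomial (Fin n) ℂ) = c • v :=
    congrArg Subtype.val hv.apply_eq_smul
  have hv0 : (v : MvPolynomial (Fin n) ℂ) ≠ 0 := fun h => hv.2 (Subtype.ext h)
  rw [smul_eq_C_mul] at h1
  have h2 := mul_right_cancel₀ hv0 h1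
  have h3 := congrArg (eval 0) h2
  have h4 := congrArg (eval 1) h2
  simp [hn.ne'] at h3
  simp [← h3] at h4

/-- Only cardinalities matter. For `n = 0` there is one admissible partition and the space is `ℂ`.
For `n > 0` any basis is infinite, and countable since the monomials are, so it can be reindexed. -/
lemma nonempty_basis_wheelSpace_two (hk : 1 ≤ k) (t : ℂ) :
    Nonempty (Module.Basis (AdmissiblePtn n k) ℂ (wheelSpace n k 2 t 1)) := by
  rcases Nat.eq_zero_or_pos n with rfl | hn
  · have htop : wheelSpace 0 k 2 t 1 = ⊤ := by
      refine eq_top_iff.2 fun f _ => ⟨fun e => ?_, fun x hx => absurd hx.1 (Nat.not_lt_zero k)⟩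
      rw [Subsingleton.elim e 1]
      exact rename_id_apply f
    have : Unique (AdmissiblePtn 0 k) :=
      { default := ⟨⟨fun i => i.elim0, fun i => i.elim0⟩, fun i => by simp⟩
        uniq := fun l => Subtype.ext (Subtype.ext (Subsingleton.elim _ _)) }
    exact ⟨(Module.Basis.singleton (AdmissiblePtn 0 k) ℂ).map
      ((LinearEquiv.ofTop _ htop).trans (isEmptyAlgEquiv ℂ (Fin 0)).toLinearEquiv).symm⟩
  · have b := Module.Basis.ofVectorSpace ℂ (wheelSpace n k 2 t 1)
    have : Infinite (AdmissiblePtn n k) := infinite_admissiblePtn hn hk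
    have : Infinite (Module.Basis.ofVectorSpaceIndex ℂ (wheelSpace n k 2 t 1)) := by
      by_contra h
      rw [not_infinite_iff_finite] at h
      exact not_finite_wheelSpace_two hn hk (Module.Finite.of_basis b)
    have : Countable (Module.Basis.ofVectorSpaceIndex ℂ (wheelSpace n k 2 t 1)) := by
      rw [← Cardinal.mk_le_aleph0_iff, b.mk_eq_rank'']
      refine (Submodule.rank_le _).trans ?_
      rw [← (basisMonomials (Fin n) ℂ).mk_eq_rank'', Cardinal.mk_le_aleph0_iff]
      infer_instance
    obtain ⟨e⟩ := nonempty_equiv_of_countable (α := AdmissiblePtn n k)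
      (β := Module.Basis.ofVectorSpaceIndex ℂ (wheelSpace n k 2 t 1))
    exact ⟨b.reindex e.symm⟩

end Basis

/-! ### Assembling the basis and the module isomorphism -/

section Free

variable {n k r : ℕ}

/-- Stated over a general semiring to serve both the `ℂ`-linear and the `frobSymm`-linear
decomposition. -/
lemma exists_linearEquiv_of_sum {S M N ι : Type*} {_ : Semiring S} {_ : AddCommMonoid M}
    {_ : AddCommMonoid N} {_ : Module S M} {_ : Module S N} [Fintype ι] (ψ : ι → M →ₗ[S] N)
    (hinj : ∀ a b : ι → M, ∑ i, ψ i (a i) = ∑ i, ψ i (b i) → a = b)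
    (hsurj : ∀ y, ∃ a : ι → M, ∑ i, ψ i (a i) = y) :
    ∃ e : (ι →₀ M) ≃ₗ[S] N, ∀ i a, e (Finsupp.single i a) = ψ i a := by
  have hΦ : ∀ a, Finsupp.lsum ℕ ψ a = ∑ i, ψ i (a i) := fun a => by
    rw [Finsupp.lsum_apply, Finsupp.sum_fintype _ _ fun i => map_zero _]
  refine ⟨LinearEquiv.ofBijective (Finsupp.lsum ℕ ψ)
    ⟨fun a b h => ?_, fun y => ?_⟩,
    fun i a => Finsupp.lsum_single ℕ ψ i a⟩
  · exact DFunLike.coe_injective (hinj a b ((hΦ a).symm.trans (h.trans (hΦ b))))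
  · obtain ⟨a, ha⟩ := hsurj y
    exact ⟨Finsupp.equivFunOnFinite.symm a, (hΦ _).trans ha⟩

/-- The map `p ↦ p(x_1^{r-1}, …, x_n^{r-1}) g` from `F_n^{(k,2)}` to `F_n^{(k,r)}`. -/
def wheelSpaceMul (hkr : Nat.Coprime (k + 1) (r - 1)) {t q : ℂ}
    (ht : t ^ (k + 1) = 1) (hq : q ^ (r - 1) = 1) {g : MvPolynomial (Fin n) ℂ}
    (hg : g.IsSymmetric) : wheelSpace n k 2 t 1 →ₗ[ℂ] wheelSpace n k r t q :=
  LinearMap.codRestrict _ ((LinearMap.mulRight ℂ g).comp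
    ((frob n (r - 1)).toLinearMap.comp (wheelSpace n k 2 t 1).subtype))
    fun p => expand_mul_mem_wheelSpace hkr ht hq p.2 hg

lemma coe_wheelSpaceMul (hkr : Nat.Coprime (k + 1) (r - 1)) {t q : ℂ}
    (ht : t ^ (k + 1) = 1) (hq : q ^ (r - 1) = 1) {g : MvPolynomial (Fin n) ℂ}
    (hg : g.IsSymmetric) (p : wheelSpace n k 2 t 1) :
    (wheelSpaceMul hkr ht hq hg p : MvPolynomial (Fin n) ℂ) = expand (r - 1) p.1 * g := rfl

/-- Multiplication by a symmetric polynomial, from `R_n` to `F_n^{(k,r)}`. -/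
def frobWheelMul (hkr : Nat.Coprime (k + 1) (r - 1)) {t q : ℂ}
    (ht : t ^ (k + 1) = 1) (hq : q ^ (r - 1) = 1) {g : MvPolynomial (Fin n) ℂ}
    (hg : g.IsSymmetric) : frobWheel n k r t →ₗ[frobSymm n (r - 1)] wheelModule n k r t q where
  toFun a := ⟨(a.1 : MvPolynomial (Fin n) ℂ) * g, by
    obtain ⟨p, hp, hpa⟩ := a.2
    rw [← hpa]
    exact expand_mul_mem_wheelSpace hkr ht hq hp hg⟩
  map_add' _ _ := Subtype.ext (add_mul _ _ _)
  map_smul' _ _ := Subtype.ext (mul_assoc _ _ _)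

lemma exists_basis_expand_mul (hr : 2 ≤ r) (hkr : Nat.Coprime (k + 1) (r - 1)) {t q : ℂ}
    (ht : IsPrimitiveRoot t (k + 1)) (hq : IsPrimitiveRoot q (r - 1))
    {g : SlimPtn n (r - 1) → MvPolynomial (Fin n) ℂ} (hg : ∀ μ, HasHighestPtn (g μ) μ.1)
    {ι : Type*} (f : Module.Basis ι ℂ (wheelSpace n k 2 t 1)) :
    ∃ B : Module.Basis (ι × SlimPtn n (r - 1)) ℂ (wheelSpace n k r t q),
      ∀ l μ, (B (l, μ) : MvPolynomial (Fin n) ℂ) =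
        frob n (r - 1) (f l : MvPolynomial (Fin n) ℂ) * g μ := by
  have hm : 0 < r - 1 := by omega
  let _ : Fintype (SlimPtn n (r - 1)) := Fintype.ofFinite _
  obtain ⟨e, he⟩ := exists_linearEquiv_of_sum (fun μ : SlimPtn n (r - 1) =>
      wheelSpaceMul hkr ht.pow_eq_one hq.pow_eq_one (hg μ).isSymmetric)
    (fun p p' h => by
      have h0 := congrArg Subtype.val h
      simp only [Submodule.coe_sum, coe_wheelSpaceMul] at h0
      exact _root_.funext fun μ => Subtype.ext (congrFun
        (eq_of_sum_expand_mul_eq hm hg (fun μ => (p μ).2.1) (fun μ => (p' μ).2.1) h0) μ))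
    (by
      rintro ⟨F, hF⟩
      obtain ⟨p, hp, rfl⟩ := exists_eq_sum_expand_mul hm hg hF.1
      refine ⟨fun μ => ⟨p μ, mem_wheelSpace_of_sum_expand_mul_mem hr hkr ht hq hg hp hF μ⟩,
        Subtype.ext ?_⟩
      simp only [Submodule.coe_sum, coe_wheelSpaceMul])
  -- One copy of the basis `f` for each slim partition, transported along `e`.
  refine ⟨((Finsupp.basis fun _ : SlimPtn n (r - 1) => f).map e).reindex
    ((Equiv.sigmaEquivProd _ _).trans (Equiv.prodComm _ _)), fun l μ => ?_⟩
  rw [Module.Basis.reindex_apply, Module.Basis.map_apply, Finsupp.coe_basis]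
  exact congrArg Subtype.val (he μ (f l))

lemma exists_linearEquiv_finsupp (hr : 2 ≤ r) (hkr : Nat.Coprime (k + 1) (r - 1)) {t q : ℂ}
    (ht : IsPrimitiveRoot t (k + 1)) (hq : IsPrimitiveRoot q (r - 1))
    {g : SlimPtn n (r - 1) → MvPolynomial (Fin n) ℂ} (hg : ∀ μ, HasHighestPtn (g μ) μ.1) :
    ∃ e : (SlimPtn n (r - 1) →₀ frobWheel n k r t) ≃ₗ[frobSymm n (r - 1)]
        wheelModule n k r t q,
      ∀ (μ : SlimPtn n (r - 1)) (a : frobWheel n k r t),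
        (e (Finsupp.single μ a) : MvPolynomial (Fin n) ℂ) =
          ((a : frobSymm n (r - 1)) : MvPolynomial (Fin n) ℂ) * g μ := by
  have hm : 0 < r - 1 := by omega
  let _ : Fintype (SlimPtn n (r - 1)) := Fintype.ofFinite _
  let ψ : SlimPtn n (r - 1) → frobWheel n k r t →ₗ[frobSymm n (r - 1)] wheelModule n k r t q :=
    fun μ => frobWheelMul hkr ht.pow_eq_one hq.pow_eq_one (hg μ).isSymmetric
  have hψ : ∀ a : SlimPtn n (r - 1) → frobWheel n k r t,
      ((∑ μ, ψ μ (a μ) : wheelModule n k r t q) : MvPolynomial (Fin n) ℂ) =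
        ∑ μ, ((a μ).1 : MvPolynomial (Fin n) ℂ) * g μ := fun a => Submodule.coe_sum ..
  have hinj : ∀ a b : SlimPtn n (r - 1) → frobWheel n k r t,
      ∑ μ, ψ μ (a μ) = ∑ μ, ψ μ (b μ) → a = b := by
    intro a b h
    have h0 := (hψ a).symm.trans ((congrArg Subtype.val h).trans (hψ b))
    choose p hp hpa using fun μ => (a μ).2
    choose p' hp' hpb using fun μ => (b μ).2
    simp only [← hpa, ← hpb] at h0
    have h2 := eq_of_sum_expand_mul_eq hm hg (fun μ => (hp μ).1) (fun μ => (hp' μ).1) h0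
    refine _root_.funext fun μ => Subtype.ext (Subtype.ext ?_)
    rw [← hpa, ← hpb, h2]
  have hsurj : ∀ F, ∃ a : SlimPtn n (r - 1) → frobWheel n k r t, ∑ μ, ψ μ (a μ) = F := by
    rintro ⟨F, hF⟩
    obtain ⟨p, hp, rfl⟩ := exists_eq_sum_expand_mul hm hg (show F.IsSymmetric from hF.1)
    exact ⟨fun μ => ⟨⟨expand (r - 1) (p μ), p μ, hp μ, rfl⟩, p μ,
      mem_wheelSpace_of_sum_expand_mul_mem hr hkr ht hq hg hp hF μ, rfl⟩, Subtype.ext (hψ _)⟩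
  obtain ⟨e, he⟩ := exists_linearEquiv_of_sum ψ hinj hsurj
  exact ⟨e, fun μ a => congrArg Subtype.val (he μ a)⟩

end Free

end

theorem theorem4 (n k r : ℕ) (hk : 1 ≤ k) (hr : 2 ≤ r) (hkr : Nat.Coprime (k + 1) (r - 1))
    (t q : ℂ) (ht : IsPrimitiveRoot t (k + 1)) (hq : IsPrimitiveRoot q (r - 1)) :
    -- bases of `F_n^{(k,2)}` indexed by admissible partitions exist
    Nonempty (Module.Basis (AdmissiblePtn n k) ℂ (wheelSpace n k 2 t 1)) ∧
    -- the number of slim partitions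
    Nat.card (SlimPtn n (r - 1)) = (r - 1) ^ n ∧
    ∀ g : SlimPtn n (r - 1) → MvPolynomial (Fin n) ℂ,
      (∀ μ, HasHighestPtn (g μ) μ.1) →
      -- the products `f_λ g_μ` form a basis of `F_n^{(k,r)}`
      (∀ f : Module.Basis (AdmissiblePtn n k) ℂ (wheelSpace n k 2 t 1),
        ∃ B : Module.Basis (AdmissiblePtn n k × SlimPtn n (r - 1)) ℂ (wheelSpace n k r t q),
          ∀ l μ, (B (l, μ) : MvPolynomial (Fin n) ℂ) =
            frob n (r - 1) (f l : MvPolynomial (Fin n) ℂ) * g μ) ∧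
      -- `F_n^{(k,r)}` is the direct sum of the `R_n g_μ`, each isomorphic to `R_n`
      ∃ e : (SlimPtn n (r - 1) →₀ frobWheel n k r t) ≃ₗ[frobSymm n (r - 1)]
          wheelModule n k r t q,
        ∀ (μ : SlimPtn n (r - 1)) (a : frobWheel n k r t),
          (e (Finsupp.single μ a) : MvPolynomial (Fin n) ℂ) =
            ((a : frobSymm n (r - 1)) : MvPolynomial (Fin n) ℂ) * g μ :=
  ⟨nonempty_basis_wheelSpace_two hk t, card_slimPtn n (r - 1), fun _ hg =>
    ⟨fun f => exists_basis_expand_mul hr hkr ht hq hg f,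
      exists_linearEquiv_finsupp hr hkr ht hq hg⟩⟩
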